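/- A $\mathcal C^\infty$-ring is a set $A$ on which every smooth function $f:\mathbb R^n\to\mathbb R$ ($n\ge 0$) is interpreted as an operation $A^n\to A$, compatibly with projections and with composition; homomorphisms are the maps commuting with all these operations. $A$ has an underlying commutative unital ring. It is a $\mathcal C^\infty$-field if this ring is a field, and von Neumann regular if for every $a\in A$ there is $x\in A$ with $a=a^2x$; $\mathcal C^\infty\mathbf{vNRing}$ is the category of von Neumann regular $\mathcal C^\infty$-rings and their homomorphisms. The $\mathcal C^\infty$-radical $\sqrt[\infty]{I}$ of an ideal $I$ is the set of all $a\in A$ such that the $\mathcal C^\infty$-ring of fractions $(A/I)\{(a+I)^{-1}\}$ is zero. $\mathrm{Spec}^\infty(A)$ is the set of prime ideals $\mathfrak p$ with $\sqrt[\infty]{\mathfrak p}=\mathfrak p$, with the topology generated by the sets $\{\mathfrak p : a\notin\mathfrak p\}$, $a\in A$. $\mathbf{BoolSp}$ is the category of Boolean spaces (compact, Hausdorff, totally disconnected) and continuous maps; $\mathrm{Spec}^\infty$ is a contravariant functor $\mathcal C^\infty\mathbf{vNRing}\to\mathbf{BoolSp}$, with $\mathrm{Spec}^\infty(f)(\mathfrak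 q)=f^{-1}(\mathfrak q)$. Theorem. Let $K$ be a $\mathcal C^\infty$-field. Define the contravariant functor $\hat k:\mathbf{BoolSp}\to\mathcal C^\infty\mathbf{vNRing}$ on objects by $\hat k(X)=A_X:=\varinjlim_{R} K^{X/R}$, where $R$ runs over the equivalence relations on $X$ such that $X/R$ is discrete and compact, directed by reverse inclusion; for continuous $f:X\to Y$, the homomorphism $\hat k(f):A_Y\to A_X$ is induced by the homomorphisms $K^{Y/R}\to K^{X/R_f}$ given by composition with $X/R_f\to Y/R$, where $R_f=(f\times f)^{-1}(R)$. Then there is a natural isomorphism $\mathrm{Id}_{\mathbf{BoolSp}}\cong\mathrm{Spec}^\infty\circ\hat k$. Moreover: - $\hat k$ is faithful; - $\mathrm{Spec}^\infty:\mathcal C^\infty\mathbf{vNRing}\to\mathbf{BoolSp}$ is full up to conjugation: for every continuous map $\varphi:X\to X'$ of Boolean spaces there are a homomorphism $f:A'\to A$ of von Neumann regular $\mathcal C^\infty$-rings and homeomorphisms $\psi:X\to\mathrm{Spec}^\infty(A)$, $\psi':X'\to\mathrm{Spec}^\infty(A')$ with $\varphi=\psi'^{-1}\circ\mathrm{Spec}^\infty(f)\circ\psi$;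 - $\mathrm{Spec}^\infty:\mathcal C^\infty\mathbf{vNRing}\to\mathbf{BoolSp}$ is isomorphism-dense (every Boolean space is isomorphic to one in its image); in particular, for every Boolean space $X$ there is a von Neumann regular $\mathcal C^\infty$-ring $A$ with $\mathrm{Spec}^\infty(A)$ homeomorphic to $X$. -/

import Mathlib

open CategoryTheory
open scoped ContDiff

universe u

namespace CInfty


open MeasureTheory in
/-- The integral over `[0, 1]` of a smooth family of functions is smooth in the parameter. -/
theorem contDiff_intervalIntegral_param {E F : Type*} [NormedAddCommGroup E] [NormedSpace ℝ E]
    [NormedAddCommGroup F] [NormedSpace ℝ F]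
    {G : E → ℝ → F} (hG : ContDiff ℝ ∞ (fun p : E × ℝ => G p.1 p.2)) :
    ContDiff ℝ ∞ (fun x => ∫ t in (0 : ℝ)..1, G x t) := by
  let χ : ContDiffBump (0 : ℝ) := ⟨2, 3, by norm_num, by norm_num⟩
  let g : E → ℝ → F := fun p s => χ s • G p (-s)
  have hg : ContDiff ℝ ∞ (fun p : E × ℝ => g p.1 p.2) := by
    have h1 : ContDiff ℝ ∞ (fun p : E × ℝ => χ p.2) := χ.contDiff.comp contDiff_snd
    have h2 : ContDiff ℝ ∞ (fun p : E × ℝ => G p.1 (-p.2)) :=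
      hG.comp (contDiff_fst.prodMk contDiff_snd.neg)
    exact h1.smul h2
  have hf : LocallyIntegrable (Set.indicator (Set.Ioc (0 : ℝ) 1) (fun _ => (1 : ℝ))) volume :=
    (locallyIntegrable_const 1).indicator measurableSet_Ioc
  have key := contDiffOn_convolution_right_with_param_comp (n := ⊤) (ContinuousLinearMap.lsmul ℝ ℝ)
    (s := Set.univ) (v := fun _ : E => (0 : ℝ)) contDiffOn_const isOpen_univ
    (isCompact_closedBall (0 : ℝ) 3) (g := g) (f := Set.indicator (Set.Ioc (0 : ℝ) 1) (fun _ => (1 : ℝ)))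
    (μ := volume) (by
      intro p x _ hx
      have : χ x = 0 := by
        rw [χ.zero_of_le_dist]
        simp only [Metric.mem_closedBall, not_le] at hx
        exact hx.le
      simp [g, this]) hf (by rw [Set.univ_prod_univ]; exact hg.contDiffOn)
  rw [contDiffOn_univ] at key
  convert key using 1
  ext x
  rw [convolution_def, intervalIntegral.integral_of_le zero_le_one, ← integral_indicator measurableSet_Ioc]
  congr 1
  ext t
  by_cases ht : t ∈ Set.Ioc (0 : ℝ) 1
  · have : χ (-t) = 1 := by
      apply χ.one_of_mem_closedBall
      rw [Metric.mem_closedBall, Real.dist_eq, sub_zero, abs_neg, abs_of_pos ht.1]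
      exact ht.2.trans (by norm_num [χ])
    simp [ht, g, this]
  · simp [ht]

/-- Hadamard's lemma. -/
theorem hadamard_lemma {n : ℕ} {f : (Fin n → ℝ) → ℝ} (hf : ContDiff ℝ ∞ f) :
    ∃ g : Fin n → (Fin (n + n) → ℝ) → ℝ, (∀ i, ContDiff ℝ ∞ (g i)) ∧
      ∀ x y : Fin n → ℝ, f x - f y = ∑ i, (x i - y i) * g i (Fin.append x y) := by
  let G : (Fin (n + n) → ℝ) → (Fin n → ℝ) →L[ℝ] ℝ := fun z => ∫ t in (0 : ℝ)..1,
    fderiv ℝ f (fun j => z (Fin.natAdd n j) + t * (z (Fin.castAdd n j) - z (Fin.natAdd n j)))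
  have hH : ContDiff ℝ ∞ (fun p : (Fin (n + n) → ℝ) × ℝ => fderiv ℝ f
      (fun j => p.1 (Fin.natAdd n j) + p.2 * (p.1 (Fin.castAdd n j) - p.1 (Fin.natAdd n j)))) := by
    have h1 : ContDiff ℝ ∞ (fderiv ℝ f) := hf.fderiv_right (by simp)
    refine h1.comp ?_
    fun_prop
  have hG : ContDiff ℝ ∞ G := contDiff_intervalIntegral_param
    (G := fun (z : Fin (n + n) → ℝ) t => fderiv ℝ f
      (fun j => z (Fin.natAdd n j) + t * (z (Fin.castAdd n j) - z (Fin.natAdd n j)))) hH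
  refine ⟨fun i z => G z (Pi.single i 1), fun i => hG.clm_apply contDiff_const, fun x y => ?_⟩
  have hd : Differentiable ℝ f := hf.differentiable (by simp)
  let c : ℝ → Fin n → ℝ := fun t j => y j + t * (x j - y j)
  have hc : ∀ t, HasDerivAt c (x - y) t := by
    intro t
    rw [hasDerivAt_pi]
    intro j
    simpa [c] using ((hasDerivAt_id t).mul_const (x j - y j)).const_add (y j)
  have hcont : Continuous (fun t => fderiv ℝ f (c t)) := by
    have := hH.continuous.comp (Continuous.prodMk_right (Fin.append x y))
    simpa only [Function.comp_def, Fin.append_left, Fin.append_right] using this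
  have h1 : ∫ t in (0 : ℝ)..1, fderiv ℝ f (c t) (x - y) = f (c 1) - f (c 0) := by
    apply intervalIntegral.integral_eq_sub_of_hasDerivAt (f := fun t => f (c t))
    · intro t _
      exact (hd (c t)).hasFDerivAt.comp_hasDerivAt t (hc t)
    · exact (hcont.clm_apply continuous_const).intervalIntegrable _ _
  have h2 : f (c 1) - f (c 0) = f x - f y := by
    simp [c]
  rw [← h2, ← h1, ← ContinuousLinearMap.intervalIntegral_apply (hcont.intervalIntegrable _ _)]
  have h3 : (∫ t in (0 : ℝ)..1, fderiv ℝ f (c t)) = G (Fin.append x y) := by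
    simp only [G, c, Fin.append_left, Fin.append_right]
  rw [h3]
  conv_lhs => rw [pi_eq_sum_univ' (x - y)]
  rw [map_sum]
  refine Finset.sum_congr rfl fun i _ => ?_
  rw [map_smul, smul_eq_mul, Pi.sub_apply]

/-! ### Smooth functions, smooth rings and their homomorphisms -/

/-- The set of smooth functions from `ℝⁿ` to `ℝ`. -/
def SmoothFn (n : ℕ) : Type := {f : (Fin n → ℝ) → ℝ // ContDiff ℝ ∞ f}

namespace SmoothFn

instance (n : ℕ) : CoeFun (SmoothFn n) (fun _ => (Fin n → ℝ) → ℝ) := ⟨Subtype.val⟩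

theorem ext {n : ℕ} {f g : SmoothFn n} (h : ∀ x, f x = g x) : f = g := Subtype.ext (funext h)

/-- The projection onto the `k`-th coordinate. -/
def proj {n : ℕ} (k : Fin n) : SmoothFn n := ⟨fun x => x k, by fun_prop⟩

/-- The composite `h ∘ (g₁, …, gₙ)`. -/
def comp {m n : ℕ} (h : SmoothFn n) (g : Fin n → SmoothFn m) : SmoothFn m :=
  ⟨fun x => h (fun i => g i x), h.2.comp (contDiff_pi.2 fun i => (g i).2)⟩

/-- Constant functions. -/
def const (n : ℕ) (c : ℝ) : SmoothFn n := ⟨fun _ => c, contDiff_const⟩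

/-- Pointwise sum. -/
def add {n : ℕ} (f g : SmoothFn n) : SmoothFn n := ⟨fun x => f x + g x, f.2.add g.2⟩

/-- Pointwise product. -/
def mul {n : ℕ} (f g : SmoothFn n) : SmoothFn n := ⟨fun x => f x * g x, f.2.mul g.2⟩

/-- Pointwise negation. -/
def neg {n : ℕ} (f : SmoothFn n) : SmoothFn n := ⟨fun x => -f x, f.2.neg⟩

/-- Finite pointwise sums. -/
def sum {n : ℕ} {ι : Type} (s : Finset ι) (g : ι → SmoothFn n) : SmoothFn n :=
  ⟨fun x => ∑ i ∈ s, g i x, ContDiff.sum fun i _ => (g i).2⟩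

end SmoothFn

/-- A `C^∞`-ring structure on `A`: every smooth `f : ℝⁿ → ℝ` is interpreted as an operation
`Aⁿ → A`, compatibly with projections and compositions. The operations with `n = 0` (real
constants) make `A` non-empty. -/
class CInftyRing (A : Type u) where
  /-- The interpretation of smooth functions. -/
  interp : ∀ {n : ℕ}, SmoothFn n → (Fin n → A) → A
  interp_proj : ∀ {n : ℕ} (k : Fin n) (x : Fin n → A), interp (SmoothFn.proj k) x = x k
  interp_comp : ∀ {m n : ℕ} (h : SmoothFn n) (g : Fin n → SmoothFn m) (x : Fin m → A),
    interp (h.comp g) x = interp h (fun i => interp (g i) x)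

/-- A homomorphism of `C^∞`-rings: a map that commutes with all the operations. -/
structure CInftyHom (A B : Type u) [CInftyRing A] [CInftyRing B] where
  /-- The underlying map. -/
  toFun : A → B
  map_interp' : ∀ {n : ℕ} (f : SmoothFn n) (x : Fin n → A),
    toFun (CInftyRing.interp f x) = CInftyRing.interp f (fun i => toFun (x i))

namespace CInftyRing

variable {A : Type u} [CInftyRing A]

/-! The underlying commutative ring: the ring operations are the interpretations of the smooth
functions `x + y`, `x * y`, `-x`, `0` and `1`. -/

instance instAdd : Add A :=
  ⟨fun a b => interp ((SmoothFn.proj 0).add (SmoothFn.proj (1 : Fin 2))) ![a, b]⟩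

instance instMul : Mul A :=
  ⟨fun a b => interp ((SmoothFn.proj 0).mul (SmoothFn.proj (1 : Fin 2))) ![a, b]⟩

instance instNeg : Neg A := ⟨fun a => interp (SmoothFn.proj (0 : Fin 1)).neg ![a]⟩

instance instZero : Zero A := ⟨interp (SmoothFn.const 0 0) ![]⟩

instance instOne : One A := ⟨interp (SmoothFn.const 0 1) ![]⟩

theorem interp_add {n : ℕ} (f g : SmoothFn n) (x : Fin n → A) : interp (f.add g) x = interp f x + interp g x := by
  have h : f.add g = ((SmoothFn.proj 0).add (SmoothFn.proj (1 : Fin 2))).comp ![f, g] :=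
    SmoothFn.ext fun x => rfl
  rw [h, interp_comp]
  change _ = interp _ _
  congr 1
  funext i
  fin_cases i <;> rfl

theorem interp_mul {n : ℕ} (f g : SmoothFn n) (x : Fin n → A) : interp (f.mul g) x = interp f x * interp g x := by
  have h : f.mul g = ((SmoothFn.proj 0).mul (SmoothFn.proj (1 : Fin 2))).comp ![f, g] :=
    SmoothFn.ext fun x => rfl
  rw [h, interp_comp]
  change _ = interp _ _
  congr 1
  funext i
  fin_cases i <;> rfl

theorem interp_neg {n : ℕ} (f : SmoothFn n) (x : Fin n → A) : interp f.neg x = -interp f x := by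
  have h : f.neg = (SmoothFn.proj (0 : Fin 1)).neg.comp ![f] := SmoothFn.ext fun x => rfl
  rw [h, interp_comp]
  change _ = interp _ _
  congr 1
  funext i
  fin_cases i
  rfl

theorem interp_zero (n : ℕ) (x : Fin n → A) : interp (SmoothFn.const n 0) x = 0 := by
  have h : SmoothFn.const n 0 = (SmoothFn.const 0 0).comp ![] := SmoothFn.ext fun x => rfl
  rw [h, interp_comp]
  change _ = interp _ _
  congr 1
  funext i
  exact i.elim0

theorem interp_one (n : ℕ) (x : Fin n → A) : interp (SmoothFn.const n 1) x = 1 := by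
  have h : SmoothFn.const n 1 = (SmoothFn.const 0 1).comp ![] := SmoothFn.ext fun x => rfl
  rw [h, interp_comp]
  change _ = interp _ _
  congr 1
  funext i
  exact i.elim0

theorem exists_interp₃ (a b c : A) : ∃ (v : Fin 3 → A) (f g h : SmoothFn 3),
    interp f v = a ∧ interp g v = b ∧ interp h v = c :=
  ⟨![a, b, c], .proj 0, .proj 1, .proj 2, interp_proj _ _, interp_proj _ _, interp_proj _ _⟩

/-- The underlying commutative unital ring of a `C^∞`-ring. -/
instance instCommRing : CommRing A :=
  CommRing.ofMinimalAxioms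
    (fun a b c => by
      obtain ⟨v, f, g, h, rfl, rfl, rfl⟩ := exists_interp₃ a b c
      rw [← interp_add, ← interp_add, ← interp_add, ← interp_add]
      exact congrArg (interp · v) (SmoothFn.ext fun x => add_assoc _ _ _))
    (fun a => by
      obtain ⟨v, f, g, h, rfl, -, -⟩ := exists_interp₃ a a a
      rw [← interp_zero 3 v, ← interp_add]
      exact congrArg (interp · v) (SmoothFn.ext fun x => zero_add _))
    (fun a => by
      obtain ⟨v, f, g, h, rfl, -, -⟩ := exists_interp₃ a a a
      rw [← interp_zero 3 v, ← interp_neg, ← interp_add]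
      exact congrArg (interp · v) (SmoothFn.ext fun x => neg_add_cancel _))
    (fun a b c => by
      obtain ⟨v, f, g, h, rfl, rfl, rfl⟩ := exists_interp₃ a b c
      rw [← interp_mul, ← interp_mul, ← interp_mul, ← interp_mul]
      exact congrArg (interp · v) (SmoothFn.ext fun x => mul_assoc _ _ _))
    (fun a b => by
      obtain ⟨v, f, g, h, rfl, rfl, -⟩ := exists_interp₃ a b b
      rw [← interp_mul, ← interp_mul]
      exact congrArg (interp · v) (SmoothFn.ext fun x => mul_comm _ _))
    (fun a => by
      obtain ⟨v, f, g, h, rfl, -, -⟩ := exists_interp₃ a a a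
      rw [← interp_one 3 v, ← interp_mul]
      exact congrArg (interp · v) (SmoothFn.ext fun x => one_mul _))
    (fun a b c => by
      obtain ⟨v, f, g, h, rfl, rfl, rfl⟩ := exists_interp₃ a b c
      rw [← interp_add, ← interp_mul, ← interp_mul, ← interp_mul, ← interp_add]
      exact congrArg (interp · v) (SmoothFn.ext fun x => mul_add _ _ _))

theorem interp_sum {n : ℕ} {ι : Type} (s : Finset ι) (g : ι → SmoothFn n) (x : Fin n → A) :
    interp (SmoothFn.sum s g) x = ∑ i ∈ s, interp (g i) x := by
  classical
  induction s using Finset.induction_on with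
  | empty =>
    rw [Finset.sum_empty, ← interp_zero n x]
    rfl
  | insert i s hi ih =>
    rw [Finset.sum_insert hi, ← ih, ← interp_add]
    exact congrArg (interp · x) (SmoothFn.ext fun y => Finset.sum_insert hi)

/-- Ideals are congruences for all the operations. -/
theorem interp_sub_mem (I : Ideal A) {n : ℕ} (f : SmoothFn n) {x y : Fin n → A}
    (h : ∀ i, x i - y i ∈ I) : interp f x - interp f y ∈ I := by
  obtain ⟨g, hg, hfg⟩ := hadamard_lemma f.2
  let v : Fin (n + n) → A := Fin.append x y
  let k : Fin n → SmoothFn (n + n) := fun i => ⟨g i, hg i⟩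
  let p : Fin n → SmoothFn (n + n) := fun i => .proj (Fin.castAdd n i)
  let q : Fin n → SmoothFn (n + n) := fun i => .proj (Fin.natAdd n i)
  have hp : ∀ i, interp (p i) v = x i := fun i => by simp only [p, v, interp_proj, Fin.append_left]
  have hq : ∀ i, interp (q i) v = y i := fun i => by simp only [q, v, interp_proj, Fin.append_right]
  have e : f.comp p = (f.comp q).add
      (SmoothFn.sum Finset.univ fun i => ((p i).add (q i).neg).mul (k i)) := by
    refine SmoothFn.ext fun z => ?_
    have := hfg (fun i => z (Fin.castAdd n i)) (fun i => z (Fin.natAdd n i))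
    rw [sub_eq_iff_eq_add'] at this
    refine this.trans ?_
    have hz : Fin.append (fun i => z (Fin.castAdd n i)) (fun i => z (Fin.natAdd n i)) = z :=
      Fin.append_castAdd_natAdd
    rw [hz]
    simp only [sub_eq_add_neg]
    rfl
  have e' := congrArg (interp · v) e
  simp only [interp_comp, interp_add, interp_sum, interp_mul, interp_neg, hp, hq, ← sub_eq_add_neg] at e'
  rw [e', add_sub_cancel_left]
  exact Ideal.sum_mem _ fun i _ => Ideal.mul_mem_right _ _ (h i)

end CInftyRing

open CInftyRing

namespace CInftyHom

variable {A B C : Type u} [CInftyRing A] [CInftyRing B] [CInftyRing C]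

instance : FunLike (CInftyHom A B) A B :=
  ⟨CInftyHom.toFun, fun f g h => by cases f; cases g; cases h; rfl⟩

@[ext]
theorem ext {f g : CInftyHom A B} (h : ∀ a, f a = g a) : f = g := DFunLike.ext _ _ h

theorem map_interp (φ : CInftyHom A B) {n : ℕ} (f : SmoothFn n) (x : Fin n → A) :
    φ (interp f x) = interp f (fun i => φ (x i)) := φ.map_interp' f x

/-- The identity homomorphism. -/
def id (A : Type u) [CInftyRing A] : CInftyHom A A := ⟨fun a => a, fun _ _ => rfl⟩

/-- The composite `g ∘ f`. -/
def comp (g : CInftyHom B C) (f : CInftyHom A B) : CInftyHom A C :=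
  ⟨fun a => g (f a), fun s x => by rw [map_interp, map_interp]⟩

@[simp] theorem id_apply (a : A) : CInftyHom.id A a = a := rfl

@[simp] theorem comp_apply (g : CInftyHom B C) (f : CInftyHom A B) (a : A) :
    g.comp f a = g (f a) := rfl

@[simp] theorem mk_apply (f : A → B) (h) (a : A) : (CInftyHom.mk f h) a = f a := rfl

/-- The underlying ring homomorphism. -/
def toRingHom (φ : CInftyHom A B) : A →+* B where
  toFun := φ
  map_zero' := by
    change φ (interp _ _) = interp _ _
    rw [map_interp]
    exact congrArg _ (funext fun i => i.elim0)
  map_one' := by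
    change φ (interp _ _) = interp _ _
    rw [map_interp]
    exact congrArg _ (funext fun i => i.elim0)
  map_add' a b := by
    change φ (interp _ _) = interp _ _
    rw [map_interp]
    exact congrArg _ (funext fun i => by fin_cases i <;> rfl)
  map_mul' a b := by
    change φ (interp _ _) = interp _ _
    rw [map_interp]
    exact congrArg _ (funext fun i => by fin_cases i <;> rfl)

@[simp] theorem toRingHom_apply (φ : CInftyHom A B) (a : A) : φ.toRingHom a = φ a := rfl

end CInftyHom

/-! ### Quotients, rings of fractions and the smooth radical -/

section Quotient

variable {A : Type u} [CInftyRing A]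

/-- The quotient `A / I` of a `C^∞`-ring by an ideal of its underlying ring. -/
def SmoothQuotient (I : Ideal A) : Type u := A ⧸ I

namespace SmoothQuotient

/-- The class of an element. -/
def toQuot (I : Ideal A) (a : A) : SmoothQuotient I := Ideal.Quotient.mk I a

/-- A representative. -/
noncomputable def out {I : Ideal A} (x : SmoothQuotient I) : A :=
  Quotient.out (s := Submodule.quotientRel I) x

theorem toQuot_eq {I : Ideal A} {a b : A} : toQuot I a = toQuot I b ↔ a - b ∈ I :=
  Ideal.Quotient.eq (I := I)

theorem toQuot_out {I : Ideal A} (x : SmoothQuotient I) : toQuot I x.out = x :=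
  Quotient.out_eq (s := Submodule.quotientRel I) x

theorem out_toQuot_sub_mem (I : Ideal A) (a : A) : (toQuot I a).out - a ∈ I :=
  toQuot_eq.1 (toQuot_out _)

theorem sub_out_toQuot_mem (I : Ideal A) (a : A) : a - (toQuot I a).out ∈ I :=
  toQuot_eq.1 (toQuot_out _).symm

/-- The operations of `A / I` are induced by those of `A`. -/
noncomputable instance (I : Ideal A) : CInftyRing (SmoothQuotient I) where
  interp f x := toQuot I (interp f fun i => (x i).out)
  interp_proj k x := by rw [interp_proj, toQuot_out]
  interp_comp h g x := by
    rw [interp_comp, toQuot_eq]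
    exact interp_sub_mem I h fun i => sub_out_toQuot_mem I _

/-- The quotient map `A → A / I`. -/
noncomputable def mk (I : Ideal A) : CInftyHom A (SmoothQuotient I) where
  toFun a := toQuot I a
  map_interp' f _ := toQuot_eq.2 (interp_sub_mem I f fun _ => sub_out_toQuot_mem I _)

theorem mk_surjective (I : Ideal A) : Function.Surjective (mk I) :=
  fun x => ⟨x.out, toQuot_out x⟩

theorem mk_eq_mk (I : Ideal A) (a b : A) : mk I a = mk I b ↔ a - b ∈ I := toQuot_eq

theorem mk_eq_zero (I : Ideal A) (a : A) : mk I a = 0 ↔ a ∈ I := by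
  rw [← map_zero (mk I).toRingHom, CInftyHom.toRingHom_apply, mk_eq_mk, sub_zero]

theorem apply_eq_of_sub_mem {I : Ideal A} {B : Type u} [CInftyRing B]
    (f : CInftyHom A B) (hf : ∀ a ∈ I, f a = 0) {a b : A} (h : a - b ∈ I) : f a = f b := by
  have := hf _ h
  rwa [← CInftyHom.toRingHom_apply, map_sub, sub_eq_zero] at this

/-- A homomorphism that kills `I` factors through `A / I`. -/
noncomputable def lift (I : Ideal A) {B : Type u} [CInftyRing B]
    (f : CInftyHom A B) (hf : ∀ a ∈ I, f a = 0) : CInftyHom (SmoothQuotient I) B where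
  toFun x := f x.out
  map_interp' s x := by
    rw [← CInftyHom.map_interp]
    exact apply_eq_of_sub_mem f hf (out_toQuot_sub_mem I _)

theorem lift_mk (I : Ideal A) {B : Type u} [CInftyRing B]
    (f : CInftyHom A B) (hf : ∀ a ∈ I, f a = 0) (a : A) : lift I f hf (mk I a) = f a :=
  apply_eq_of_sub_mem f hf (out_toQuot_sub_mem I _)

end SmoothQuotient

/-- `η : A → L` is the `C^∞`-ring of fractions `A{S⁻¹}`: it makes the elements of `S` invertible,
and it is universal among homomorphisms of `C^∞`-rings that do so. -/
structure IsSmoothFractions (S : Set A) {L : Type u} [CInftyRing L] (η : CInftyHom A L) :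
    Prop where
  isUnit : ∀ a ∈ S, IsUnit (η a)
  existsUnique_lift : ∀ (B : Type u) [CInftyRing B] (f : CInftyHom A B),
    (∀ a ∈ S, IsUnit (f a)) → ∃! g : CInftyHom L B, g.comp η = f

/-- The `C^∞`-radical of an ideal `I`: the set of all `a` such that the ring of fractions
`(A / I){(a + I)⁻¹}` is the zero ring. -/
def smoothRadical (I : Ideal A) : Set A :=
  {a | ∃ (L : Type u) (_ : CInftyRing L) (η : CInftyHom (SmoothQuotient I) L),
    IsSmoothFractions {SmoothQuotient.mk I a} η ∧ Subsingleton L}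

/-- The zero `C^∞`-ring. -/
def ZeroRing : Type u := PUnit

instance : Subsingleton ZeroRing.{u} := inferInstanceAs (Subsingleton PUnit)

instance : CInftyRing ZeroRing.{u} where
  interp _ _ := PUnit.unit
  interp_proj _ _ := rfl
  interp_comp _ _ _ := rfl

theorem mem_smoothRadical_iff (I : Ideal A) (a : A) : a ∈ smoothRadical I ↔
    ∀ (B : Type u) [CInftyRing B] (f : CInftyHom A B), (∀ b ∈ I, f b = 0) → IsUnit (f a) →
      Subsingleton B := by
  constructor
  · rintro ⟨L, _, η, hη, hL⟩ B _ f hf ha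
    obtain ⟨g, -, -⟩ := hη.existsUnique_lift B (SmoothQuotient.lift I f hf) (by
      rintro _ rfl
      rwa [SmoothQuotient.lift_mk])
    refine subsingleton_of_zero_eq_one ?_
    rw [← map_zero g.toRingHom, ← map_one g.toRingHom, Subsingleton.elim (0 : L) 1]
  · intro h
    refine ⟨ZeroRing, inferInstance, ⟨fun _ => 0, fun _ _ => Subsingleton.elim _ _⟩,
      ⟨fun _ _ => ?_, fun B _ f hf => ?_⟩, inferInstance⟩
    · exact isUnit_of_subsingleton _
    · have : Subsingleton B := h B (f.comp (SmoothQuotient.mk I))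
        (fun b hb => by
          rw [CInftyHom.comp_apply, (SmoothQuotient.mk_eq_zero I b).2 hb]
          exact map_zero f.toRingHom) (hf _ rfl)
      exact ⟨⟨fun _ => 0, fun _ _ => Subsingleton.elim _ _⟩,
        CInftyHom.ext fun _ => Subsingleton.elim _ _,
        fun _ _ => CInftyHom.ext fun _ => Subsingleton.elim _ _⟩

theorem subset_smoothRadical (I : Ideal A) : (I : Set A) ⊆ smoothRadical I := by
  intro a ha
  rw [mem_smoothRadical_iff]
  intro B _ f hf hu
  rw [hf a ha] at hu
  exact subsingleton_of_zero_eq_one (isUnit_zero_iff.1 hu)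

end Quotient

/-! ### The smooth spectrum -/

/-- The underlying set of `Spec^∞ A`: the prime ideals that agree with their `C^∞`-radical. -/
def SpecInf (A : Type u) [CInftyRing A] : Type u :=
  {p : Ideal A // p.IsPrime ∧ smoothRadical p = (p : Set A)}

namespace SpecInf

/-- The basic open set of all points not containing `a`. -/
def basicOpen {A : Type u} [CInftyRing A] (a : A) : Set (SpecInf A) := {p | a ∉ p.1}

/-- The smooth Zariski topology, generated by the basic open sets. -/
instance (A : Type u) [CInftyRing A] : TopologicalSpace (SpecInf A) :=
  TopologicalSpace.generateFrom (Set.range basicOpen)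

/-- The map `Spec^∞ B → Spec^∞ A`, `q ↦ f⁻¹(q)`, induced by `f : A → B`. -/
def comap {A B : Type u} [CInftyRing A] [CInftyRing B] (f : CInftyHom A B) (q : SpecInf B) :
    SpecInf A :=
  ⟨q.1.comap f.toRingHom, by
    have := q.2.1
    refine ⟨inferInstance, (subset_smoothRadical _).antisymm' fun a ha => ?_⟩
    change f a ∈ (q.1 : Set B)
    rw [← q.2.2, mem_smoothRadical_iff]
    intro C _ g hg hu
    exact (mem_smoothRadical_iff _ _).1 ha C (g.comp f) (fun b hb => hg _ hb) hu⟩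

theorem continuous_comap {A B : Type u} [CInftyRing A] [CInftyRing B] (f : CInftyHom A B) :
    Continuous (comap f) := by
  refine continuous_generateFrom_iff.2 ?_
  rintro _ ⟨a, rfl⟩
  exact TopologicalSpace.isOpen_generateFrom_of_mem ⟨f a, rfl⟩

end SpecInf

/-- `C^∞`-fields: the underlying ring is a field. -/
def IsCInftyField (K : Type u) [CInftyRing K] : Prop := IsField K

/-- Von Neumann regular `C^∞`-rings. -/
def IsVonNeumannRegular (A : Type u) [CInftyRing A] : Prop := ∀ a : A, ∃ x : A, a = a ^ 2 * x

theorem smoothRadical_eq_of_isPrime {A : Type u} [CInftyRing A] (hA : IsVonNeumannRegular A)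
    (p : Ideal A) (hp : p.IsPrime) : smoothRadical p = (p : Set A) := by
  refine (subset_smoothRadical _).antisymm' fun a ha => ?_
  by_contra hap
  obtain ⟨x, hx⟩ := hA a
  have h1 : 1 - a * x ∈ p := by
    have h0 : a * (1 - a * x) ∈ p := by
      have : a * (1 - a * x) = a - a ^ 2 * x := by ring
      rw [this, ← hx, sub_self]
      exact p.zero_mem
    exact (hp.mem_or_mem h0).resolve_left hap
  have := (mem_smoothRadical_iff _ _).1 ha (SmoothQuotient p) (SmoothQuotient.mk p)
    (fun b hb => (SmoothQuotient.mk_eq_zero p b).2 hb) (by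
      refine IsUnit.of_mul_eq_one (SmoothQuotient.mk p x) ?_
      have h2 := (SmoothQuotient.mk_eq_zero p _).2 h1
      rw [← CInftyHom.toRingHom_apply, map_sub, map_one, map_mul, sub_eq_zero] at h2
      exact h2.symm)
  refine hp.ne_top ((Ideal.eq_top_iff_one _).2 ?_)
  rw [← SmoothQuotient.mk_eq_zero]
  exact Subsingleton.elim _ _

section Boolean

variable {A : Type u} [CInftyRing A]

/-- In the von Neumann regular case every prime ideal is a point of the smooth spectrum. -/
def SpecInf.ofPrime (hA : IsVonNeumannRegular A) (p : PrimeSpectrum A) : SpecInf A :=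
  ⟨p.asIdeal, p.isPrime, smoothRadical_eq_of_isPrime hA _ p.isPrime⟩

theorem SpecInf.compactSpace (hA : IsVonNeumannRegular A) : CompactSpace (SpecInf A) := by
  have hc : Continuous (SpecInf.ofPrime hA) := by
    refine continuous_generateFrom_iff.2 ?_
    rintro _ ⟨a, rfl⟩
    exact (PrimeSpectrum.basicOpen a).isOpen
  have hs : Function.Surjective (SpecInf.ofPrime hA) := fun p => ⟨⟨p.1, p.2.1⟩, rfl⟩
  exact hs.compactSpace hc

theorem SpecInf.isOpen_basicOpen (a : A) : IsOpen (SpecInf.basicOpen a) :=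
  TopologicalSpace.isOpen_generateFrom_of_mem ⟨a, rfl⟩

theorem SpecInf.isClopen_basicOpen (hA : IsVonNeumannRegular A) (a : A) :
    IsClopen (SpecInf.basicOpen a) := by
  obtain ⟨x, hx⟩ := hA a
  have h : (SpecInf.basicOpen a)ᶜ = SpecInf.basicOpen (1 - a * x) := by
    ext p
    have hp := p.2.1
    simp only [SpecInf.basicOpen, Set.mem_compl_iff, Set.mem_ofPred_eq, not_not]
    constructor
    · intro ha h1
      refine hp.ne_top ((Ideal.eq_top_iff_one _).2 ?_)
      have := p.1.add_mem h1 (p.1.mul_mem_right x ha)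
      rwa [sub_add_cancel] at this
    · intro h1
      have h0 : a * (1 - a * x) ∈ p.1 := by
        have : a * (1 - a * x) = a - a ^ 2 * x := by ring
        rw [this, ← hx, sub_self]
        exact p.1.zero_mem
      exact (hp.mem_or_mem h0).resolve_right h1
  refine ⟨⟨?_⟩, SpecInf.isOpen_basicOpen a⟩
  rw [h]
  exact SpecInf.isOpen_basicOpen _

theorem SpecInf.totallySeparatedSpace (hA : IsVonNeumannRegular A) :
    TotallySeparatedSpace (SpecInf A) := by
  refine totallySeparatedSpace_iff_exists_isClopen.2 fun p q hpq => ?_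
  by_cases h : p.1 ≤ q.1
  · have h' : ¬ q.1 ≤ p.1 := fun h' => hpq (Subtype.ext (le_antisymm h h'))
    obtain ⟨a, haq, hap⟩ := SetLike.not_le_iff_exists.1 h'
    exact ⟨SpecInf.basicOpen a, SpecInf.isClopen_basicOpen hA a, hap, fun h => h haq⟩
  · obtain ⟨a, hap, haq⟩ := SetLike.not_le_iff_exists.1 h
    exact ⟨(SpecInf.basicOpen a)ᶜ, (SpecInf.isClopen_basicOpen hA a).compl,
      fun h => h hap, fun h => h haq⟩

end Boolean

/-! ### The categories and the functor `Spec^∞` -/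

/-- The category of `C^∞`-rings. -/
structure CInftyRingCat where
  /-- The underlying set. -/
  carrier : Type u
  [str : CInftyRing carrier]

instance : CoeSort CInftyRingCat.{u} (Type u) := ⟨CInftyRingCat.carrier⟩

instance (A : CInftyRingCat.{u}) : CInftyRing A := A.str

/-- Morphisms in the category of `C^∞`-rings. -/
@[ext]
structure CInftyRingCat.Hom (A B : CInftyRingCat.{u}) where
  /-- The underlying homomorphism of `C^∞`-rings. -/
  hom : CInftyHom A B

instance : Category CInftyRingCat.{u} where
  Hom A B := CInftyRingCat.Hom A B
  id A := ⟨CInftyHom.id A⟩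
  comp f g := ⟨g.hom.comp f.hom⟩

theorem CInftyRingCat.hom_ext {A B : CInftyRingCat.{u}} {f g : A ⟶ B}
    (h : ∀ a, f.hom a = g.hom a) : f = g :=
  CInftyRingCat.Hom.ext (CInftyHom.ext h)

theorem CInftyRingCat.comp_hom_apply {A B C : CInftyRingCat.{u}} (f : A ⟶ B) (g : B ⟶ C) (a : A) :
    (f ≫ g).hom a = g.hom (f.hom a) := rfl

theorem CInftyRingCat.id_hom_apply {A : CInftyRingCat.{u}} (a : A) :
    CInftyRingCat.Hom.hom (𝟙 A) a = a := rfl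

theorem CInftyRingCat.hom_congr {A B : CInftyRingCat.{u}} {f g : A ⟶ B} (h : f = g) (a : A) :
    f.hom a = g.hom a := by rw [h]

/-- The category of von Neumann regular `C^∞`-rings, a full subcategory. -/
abbrev CInftyVNRing : Type (u + 1) :=
  ObjectProperty.FullSubcategory fun A : CInftyRingCat.{u} => IsVonNeumannRegular A

/-- The category of Boolean spaces: compact Hausdorff totally disconnected spaces and continuous
maps. -/
abbrev BoolSp : Type (u + 1) := Profinite.{u}

/-- `Spec^∞ A` as a Boolean space. -/
def specObj (A : CInftyVNRing.{u}) : BoolSp.{u} :=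
  have := SpecInf.compactSpace A.property
  have := SpecInf.totallySeparatedSpace A.property
  Profinite.of (SpecInf A.obj)

/-- The contravariant functor `Spec^∞`, sending `f` to `q ↦ f⁻¹(q)`. -/
def specFunctor : CInftyVNRing.{u}ᵒᵖ ⥤ BoolSp.{u} where
  obj A := specObj A.unop
  map f := ConcreteCategory.ofHom
    (⟨SpecInf.comap f.unop.hom.hom, SpecInf.continuous_comap f.unop.hom.hom⟩ :
      C(specObj (Opposite.unop _), specObj (Opposite.unop _)))

/-! ### The functor `k̂` -/

/-- The power `K^S`, with the pointwise operations. -/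
def Power (K S : Type u) : Type u := S → K

instance (K S : Type u) [CInftyRing K] : CInftyRing (Power K S) where
  interp f φ := fun s => interp f fun i => φ i s
  interp_proj k φ := funext fun s => interp_proj k fun i => φ i s
  interp_comp h g φ := funext fun s => interp_comp h g fun i => φ i s

/-- The homomorphism `K^T → K^S` given by composition with `g : S → T`. -/
def Power.map (K : Type u) [CInftyRing K] {S T : Type u} (g : S → T) :
    CInftyHom (Power K T) (Power K S) := ⟨fun φ s => φ (g s), fun _ _ => rfl⟩

section Khat

variable (K : Type u) [CInftyRing K]

/-- The directed diagram `R ↦ K^(X/R)` indexed by the equivalence relations `R` on `X` with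
discrete quotient, a finer relation coming later; if `R' ⊆ R`, the transition map is composition
with `X/R' → X/R`. (`X` is compact, so the discrete quotients are finite.) -/
def powerDiagram (X : BoolSp.{u}) : (DiscreteQuotient X)ᵒᵖ ⥤ CInftyRingCat.{u} where
  obj R := ⟨Power K R.unop⟩
  map h := ⟨Power.map K (DiscreteQuotient.ofLE (leOfHom h.unop))⟩
  map_id _ := CInftyRingCat.hom_ext fun φ => funext fun s =>
    congrArg φ (DiscreteQuotient.ofLE_refl_apply s)
  map_comp f g := CInftyRingCat.hom_ext fun φ => funext fun s =>
    congrArg φ (DiscreteQuotient.ofLE_ofLE (leOfHom g.unop) (leOfHom f.unop) s).symm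

/-! The existence of a colimit of this diagram is shown by means of locally constant functions. -/

/-- Locally constant functions from `X` to `K`, with the pointwise operations. -/
@[ext]
structure LocConst (X : Type u) [TopologicalSpace X] where
  /-- The underlying locally constant map. -/
  val : LocallyConstant X K

theorem LocConst.ext_apply {K X : Type u} [TopologicalSpace X] {φ ψ : LocConst K X}
    (h : ∀ x, φ.val x = ψ.val x) : φ = ψ := LocConst.ext (LocallyConstant.ext h)

variable {K} in
theorem isLocallyConstant_interp {X : Type u} [TopologicalSpace X] {n : ℕ} (f : SmoothFn n)
    (φ : Fin n → LocallyConstant X K) :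
    IsLocallyConstant fun x => interp f fun i => φ i x := by
  refine (IsLocallyConstant.iff_eventually_eq _).2 fun x => ?_
  have h : ∀ᶠ y in nhds x, ∀ i, φ i y = φ i x := Filter.eventually_all.2 fun i =>
    (IsLocallyConstant.iff_eventually_eq _).1 (φ i).isLocallyConstant x
  filter_upwards [h] with y hy
  exact congrArg (interp f) (funext hy)

instance (X : Type u) [TopologicalSpace X] : CInftyRing (LocConst K X) where
  interp f φ := ⟨⟨fun x => interp f fun i => (φ i).val x,
    isLocallyConstant_interp f fun i => (φ i).val⟩⟩
  interp_proj k φ := LocConst.ext_apply fun x => interp_proj k fun i => (φ i).val x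
  interp_comp h g φ := LocConst.ext_apply fun x => interp_comp h g fun i => (φ i).val x

/-- Evaluation at a point. -/
def LocConst.ev {X : Type u} [TopologicalSpace X] (x : X) : CInftyHom (LocConst K X) K :=
  ⟨fun φ => φ.val x, fun _ _ => rfl⟩

variable (X : BoolSp.{u})

/-- The homomorphism `K^(X/R) → LocConst K X` given by composition with `X → X/R`. -/
def locConstι (R : DiscreteQuotient X) : CInftyHom (Power K R) (LocConst K X) where
  toFun φ := ⟨⟨fun x => φ (R.proj x), R.proj_isLocallyConstant.comp φ⟩⟩
  map_interp' _ _ := rfl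

/-- The cocone with vertex `LocConst K X`. -/
def locConstCocone : Limits.Cocone (powerDiagram K X) where
  pt := ⟨LocConst K X⟩
  ι :=
    { app := fun R => ⟨locConstι K X R.unop⟩
      naturality := fun _ _ _ => rfl }

variable {K X}

theorem locConstι_injective (R : DiscreteQuotient X) : Function.Injective (locConstι K X R) := by
  intro φ ψ h
  funext s
  obtain ⟨x, rfl⟩ := R.proj_surjective s
  exact congrArg (fun χ : LocConst K X => χ.val x) h

/-- A locally constant function as a function on its own discrete quotient. -/
def LocConst.lift (φ : LocConst K X) : Power K φ.val.discreteQuotient :=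
  fun s => φ.val.lift s

theorem LocConst.ι_lift (φ : LocConst K X) : locConstι K X _ φ.lift = φ := rfl

theorem exists_locConstι {ι : Type} [Finite ι] (φ : ι → LocConst K X) :
    ∃ (R : DiscreteQuotient X) (ψ : ι → Power K R), ∀ i, locConstι K X R (ψ i) = φ i := by
  classical
  have := Fintype.ofFinite ι
  let D : ι → DiscreteQuotient X := fun i => (φ i).val.discreteQuotient
  let R : DiscreteQuotient X := Finset.univ.inf D
  have hR : ∀ i, R ≤ D i := fun i => Finset.inf_le (Finset.mem_univ i)
  exact ⟨R, fun i s => (φ i).lift (DiscreteQuotient.ofLE (hR i) s), fun i => rfl⟩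

/-- The component of a cocone at `R`. -/
def coconeHom (s : Limits.Cocone (powerDiagram K X)) (R : DiscreteQuotient X) :
    CInftyHom (Power K R) s.pt := (s.ι.app (.op R)).hom

theorem coconeHom_ofLE (s : Limits.Cocone (powerDiagram K X)) {R R' : DiscreteQuotient X}
    (h : R' ≤ R) (φ : Power K R) :
    coconeHom s R' (fun x => φ (DiscreteQuotient.ofLE h x)) = coconeHom s R φ :=
  CInftyRingCat.hom_congr (s.w (homOfLE h).op) φ

theorem coconeHom_eq (s : Limits.Cocone (powerDiagram K X)) {R R' : DiscreteQuotient X}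
    (φ : Power K R) (φ' : Power K R') (h : locConstι K X R φ = locConstι K X R' φ') :
    coconeHom s R φ = coconeHom s R' φ' := by
  rw [← coconeHom_ofLE s (inf_le_left : R ⊓ R' ≤ R), ← coconeHom_ofLE s (inf_le_right : R ⊓ R' ≤ R')]
  exact congrArg _ (locConstι_injective _ h)

/-- The comparison map out of the locally constant functions. -/
def locConstDesc (s : Limits.Cocone (powerDiagram K X)) : CInftyHom (LocConst K X) s.pt where
  toFun φ := coconeHom s _ φ.lift
  map_interp' f φ := by
    obtain ⟨R, ψ, hψ⟩ := exists_locConstι φ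
    have e : ∀ i, coconeHom s _ (φ i).lift = coconeHom s R (ψ i) := fun i =>
      coconeHom_eq s _ _ (hψ i).symm
    simp only [e]
    rw [← CInftyHom.map_interp]
    refine coconeHom_eq s _ _ ?_
    rw [CInftyHom.map_interp, LocConst.ι_lift]
    simp only [hψ]

/-- The locally constant functions form a colimit of the diagram. -/
def isColimitLocConst : Limits.IsColimit (locConstCocone K X) where
  desc s := ⟨locConstDesc s⟩
  fac s _ := CInftyRingCat.hom_ext fun _ => coconeHom_eq s _ _ rfl
  uniq _ _ hm := CInftyRingCat.hom_ext fun φ =>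
    CInftyRingCat.hom_congr (hm (.op (LocallyConstant.discreteQuotient (LocConst.val φ))))
      (LocConst.lift φ)

instance : Limits.HasColimit (powerDiagram K X) := ⟨⟨⟨_, isColimitLocConst⟩⟩⟩

theorem isVonNeumannRegular_locConst (hK : IsCInftyField K) (X : Type u) [TopologicalSpace X] :
    IsVonNeumannRegular (LocConst K X) := by
  classical
  have h : ∀ a : K, ∃ b : K, a = a ^ 2 * b := fun a => by
    by_cases ha : a = 0
    · exact ⟨0, by simp [ha]⟩
    · obtain ⟨b, hb⟩ := hK.mul_inv_cancel ha
      exact ⟨b, by rw [pow_two, mul_assoc, hb, mul_one]⟩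
  choose b hb using h
  intro φ
  refine ⟨⟨φ.val.map b⟩, LocConst.ext_apply fun x => ?_⟩
  have e : (LocConst.ev K x).toRingHom φ =
      (LocConst.ev K x).toRingHom (φ ^ 2 * (⟨φ.val.map b⟩ : LocConst K X)) := by
    rw [map_mul, map_pow]
    exact hb _
  exact e

theorem isVonNeumannRegular_colimit (hK : IsCInftyField K) (X : BoolSp.{u}) :
    IsVonNeumannRegular (Limits.colimit (powerDiagram K X)).carrier := by
  let i := (isColimitLocConst (K := K) (X := X)).coconePointUniqueUpToIso
    (Limits.colimit.isColimit (powerDiagram K X))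
  let e : CInftyHom (LocConst K X) (Limits.colimit (powerDiagram K X)).carrier := i.hom.hom
  let e' : CInftyHom (Limits.colimit (powerDiagram K X)).carrier (LocConst K X) := i.inv.hom
  have h : ∀ a, e.toRingHom (e' a) = a := fun a => CInftyRingCat.hom_congr i.inv_hom_id a
  intro a
  obtain ⟨x, hx⟩ := isVonNeumannRegular_locConst hK X (e' a)
  refine ⟨e.toRingHom x, ?_⟩
  have := congrArg e.toRingHom hx
  rwa [map_mul, map_pow, h] at this

/-- The object `A_X = colim_R K^(X/R)` of the category of von Neumann regular `C^∞`-rings. -/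
noncomputable def khatObj (hK : IsCInftyField K) (X : BoolSp.{u}) : CInftyVNRing.{u} :=
  ⟨Limits.colimit (powerDiagram K X), isVonNeumannRegular_colimit hK X⟩

variable (K)

/-- The homomorphism `K^(X/R) → A_X` into the colimit. -/
noncomputable def khatι (X : BoolSp.{u}) (R : DiscreteQuotient X) :
    (⟨Power K R⟩ : CInftyRingCat.{u}) ⟶ Limits.colimit (powerDiagram K X) :=
  Limits.colimit.ι (powerDiagram K X) (.op R)

theorem khatι_ofLE (X : BoolSp.{u}) {R R' : DiscreteQuotient X} (h : R' ≤ R) (φ : Power K R) :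
    (khatι K X R').hom (fun s => φ (DiscreteQuotient.ofLE h s)) = (khatι K X R).hom φ :=
  coconeHom_ofLE (Limits.colimit.cocone (powerDiagram K X)) h φ

/-- For continuous `f : X → Y` and a relation `R` on `Y` with inverse image `R_f` on `X`, the
homomorphism `K^(Y/R) → K^(X/R_f)` given by composition with `X/R_f → Y/R`. -/
def powerPullback {X Y : BoolSp.{u}} (f : C(X, Y)) (R : DiscreteQuotient Y) :
    CInftyHom (Power K R) (Power K (R.comap f)) :=
  Power.map K (DiscreteQuotient.map f (le_refl (R.comap f)))

/-- The cocone under the diagram of `Y` with vertex `A_X` and components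
`K^(Y/R) → K^(X/R_f) → A_X`. -/
noncomputable def pullbackCocone {X Y : BoolSp.{u}} (f : C(X, Y)) :
    Limits.Cocone (powerDiagram K Y) where
  pt := Limits.colimit (powerDiagram K X)
  ι :=
    { app := fun R => ⟨(khatι K X (R.unop.comap f)).hom.comp (powerPullback K f R.unop)⟩
      naturality := fun R R' h => CInftyRingCat.hom_ext fun φ => by
        refine Eq.trans ?_ (khatι_ofLE K X
          (DiscreteQuotient.comap_mono f (leOfHom h.unop)) (powerPullback K f R.unop φ))
        refine congrArg (khatι K X _).hom (funext fun s => ?_)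
        obtain ⟨x, rfl⟩ := DiscreteQuotient.proj_surjective _ s
        rfl }

variable {K}

/-- The action of `k̂` on a continuous map `f : X → Y`: the induced map `A_Y → A_X`. -/
noncomputable def khatMap {X Y : BoolSp.{u}} (f : C(X, Y)) :
    Limits.colimit (powerDiagram K Y) ⟶ Limits.colimit (powerDiagram K X) :=
  Limits.colimit.desc _ (pullbackCocone K f)

theorem khatMap_ι {X Y : BoolSp.{u}} (f : C(X, Y)) (R : DiscreteQuotient Y) (φ : Power K R) :
    (khatMap f).hom ((khatι K Y R).hom φ) =
      (khatι K X (R.comap f)).hom (powerPullback K f R φ) :=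
  CInftyRingCat.hom_congr (Limits.colimit.ι_desc (pullbackCocone K f) (.op R)) φ

theorem khat_hom_ext {X : BoolSp.{u}} {A : CInftyRingCat.{u}}
    {g h : Limits.colimit (powerDiagram K X) ⟶ A}
    (H : ∀ (R : DiscreteQuotient X) (φ : Power K R),
      g.hom ((khatι K X R).hom φ) = h.hom ((khatι K X R).hom φ)) : g = h :=
  Limits.colimit.hom_ext fun R => CInftyRingCat.hom_ext fun φ => H R.unop φ

/-- The contravariant functor `k̂ : X ↦ A_X = colim_R K^(X/R)`. -/
noncomputable def khat (hK : IsCInftyField K) : BoolSp.{u}ᵒᵖ ⥤ CInftyVNRing.{u} where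
  obj X := khatObj hK X.unop
  map f := ObjectProperty.homMk (khatMap f.unop.hom.hom)
  map_id X := by
    refine ObjectProperty.hom_ext _ (khat_hom_ext fun R φ => ?_)
    refine (khatMap_ι _ R φ).trans ?_
    refine congrArg (khatι K X.unop R).hom (funext fun s => ?_)
    obtain ⟨x, rfl⟩ := R.proj_surjective s
    rfl
  map_comp f g := by
    refine ObjectProperty.hom_ext _ (khat_hom_ext fun R φ => ?_)
    refine (khatMap_ι _ R φ).trans ?_
    refine Eq.trans ?_ (congrArg (khatMap _).hom (khatMap_ι f.unop.hom.hom R φ)).symm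
    refine Eq.trans ?_ (khatMap_ι g.unop.hom.hom _ _).symm
    refine congrArg (khatι K _ _).hom (funext fun s => ?_)
    obtain ⟨x, rfl⟩ := DiscreteQuotient.proj_surjective _ s
    rfl

end Khat

/-- A functor `F : C ⥤ D` is full up to conjugation if every morphism `φ : X ⟶ Y` of `D` is of
the form `ψ' ⁻¹ ∘ F(f) ∘ ψ` for a morphism `f : A ⟶ B` of `C` and isomorphisms `ψ : X ≅ F(A)`,
`ψ' : Y ≅ F(B)`. -/
def FullUpToConjugation {C D : Type*} [Category C] [Category D] (F : C ⥤ D) : Prop :=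
  ∀ ⦃X Y : D⦄ (φ : X ⟶ Y), ∃ (A B : C) (f : A ⟶ B) (ψ : X ≅ F.obj A) (ψ' : Y ≅ F.obj B),
    φ = ψ.hom ≫ F.map f ≫ ψ'.inv

end CInfty

/-!
The colimit `A_X` is the ring of locally constant functions `X → K`, so every point `x : X` gives
an evaluation homomorphism `A_X → K`, whose kernel is a prime ideal, hence (as `A_X` is von Neumann
regular) a point of `Spec^∞ A_X`. This map `X → Spec^∞ A_X` is

* continuous, since the vanishing locus of a locally constant function is clopen;
* injective, since the indicator function of a clopen set that separates two points lies in only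
  one of the two kernels;
* surjective: its range is compact, hence closed, and it is dense, because a nonempty basic open
  set is given by a nonzero function, which does not vanish at some point.

A continuous bijection of Boolean spaces is a homeomorphism. Pulling back along `f : X → Y` turns
evaluation at `x` into evaluation at `f x`, whence naturality. The other claims are formal
consequences of the natural isomorphism `Id ≅ Spec^∞ ∘ k̂`.
-/

namespace CInfty

open CInftyRing

section Evaluation

variable {K : Type u} [CInftyRing K]

/-- The isomorphism between `A_X` and the ring of locally constant functions on `X`. -/
noncomputable def khatIsoLocConst (X : BoolSp.{u}) :
    Limits.colimit (powerDiagram K X) ≅ (⟨LocConst K X⟩ : CInftyRingCat.{u}) :=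
  (Limits.colimit.isColimit (powerDiagram K X)).coconePointUniqueUpToIso isColimitLocConst

/-- Evaluation `A_X → K` at a point of `X`. -/
noncomputable def khatEval {X : BoolSp.{u}} (x : X) :
    Limits.colimit (powerDiagram K X) ⟶ (⟨K⟩ : CInftyRingCat.{u}) :=
  (khatIsoLocConst X).hom ≫ ⟨LocConst.ev K x⟩

theorem khatEval_ι {X : BoolSp.{u}} (x : X) (R : DiscreteQuotient X) (φ : Power K R) :
    (khatEval x).hom ((khatι K X R).hom φ) = φ (R.proj x) :=
  congrArg (fun ψ : LocConst K X => ψ.val x) (CInftyRingCat.hom_congr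
    ((Limits.colimit.isColimit (powerDiagram K X)).comp_coconePointUniqueUpToIso_hom
      isColimitLocConst (.op R)) φ)

theorem khatEval_khatMap {X Y : BoolSp.{u}} (f : C(X, Y)) (x : X)
    (a : (Limits.colimit (powerDiagram K Y)).carrier) :
    (khatEval x).hom ((khatMap f).hom a) = (khatEval (f x)).hom a := by
  have h : khatMap f ≫ khatEval x = khatEval (K := K) (f x) := khat_hom_ext fun R φ => by
    rw [CInftyRingCat.comp_hom_apply, khatMap_ι, khatEval_ι, khatEval_ι]
    rfl
  exact CInftyRingCat.hom_congr h a

/-- Every locally constant function arises from an element of `A_X`. -/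
theorem exists_khatEval_eq {X : BoolSp.{u}} (φ : LocallyConstant X K) :
    ∃ a, ∀ x, (khatEval x).hom a = φ x :=
  ⟨(khatι K X φ.discreteQuotient).hom (φ.lift : _ → K), fun x => khatEval_ι x _ _⟩

theorem eq_zero_of_khatEval_eq_zero {X : BoolSp.{u}}
    {a : (Limits.colimit (powerDiagram K X)).carrier}
    (ha : ∀ x : X, (khatEval x).hom a = 0) : a = 0 := by
  have h : (khatIsoLocConst X).hom.hom a = 0 := LocConst.ext_apply fun x =>
    (ha x).trans (map_zero (LocConst.ev K x).toRingHom).symm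
  have e : (khatIsoLocConst X).inv.hom ((khatIsoLocConst X).hom.hom a) = a :=
    CInftyRingCat.hom_congr (khatIsoLocConst X).hom_inv_id a
  rw [← e, h]
  exact map_zero (khatIsoLocConst X).inv.hom.toRingHom

theorem isLocallyConstant_khatEval {X : BoolSp.{u}}
    (a : (Limits.colimit (powerDiagram K X)).carrier) :
    IsLocallyConstant fun x : X => (khatEval x).hom a :=
  LocallyConstant.isLocallyConstant
    (LocConst.val (K := K) (X := X) ((khatIsoLocConst X).hom.hom a))

end Evaluation

theorem SpecInf.isTopologicalBasis_basicOpen (A : Type u) [CInftyRing A] :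
    TopologicalSpace.IsTopologicalBasis (insert Set.univ (Set.range (basicOpen (A := A)))) := by
  refine TopologicalSpace.isTopologicalBasis_of_subbasis_of_inter rfl ?_
  rintro _ ⟨a, rfl⟩ _ ⟨b, rfl⟩
  refine ⟨a * b, Set.ext fun p => ?_⟩
  have := p.2.1
  exact (this.mul_mem_iff_mem_or_mem (x := a) (y := b)).not.trans not_or

section EvalPoint

variable {K : Type u} [CInftyRing K] (hK : IsCInftyField K)

/-- The point of `Spec^∞ A_X` given by the functions that vanish at `x`. -/
noncomputable def evalPoint {X : BoolSp.{u}} (x : X) :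
    SpecInf (Limits.colimit (powerDiagram K X)).carrier :=
  SpecInf.ofPrime (isVonNeumannRegular_colimit hK X)
    ⟨RingHom.ker (khatEval x).hom.toRingHom, by
      have : IsDomain K := hK.isDomain
      exact RingHom.ker_isPrime _⟩

theorem mem_evalPoint {X : BoolSp.{u}} {x : X}
    {a : (Limits.colimit (powerDiagram K X)).carrier} :
    a ∈ (evalPoint hK x).1 ↔ (khatEval x).hom a = 0 := Iff.rfl

theorem continuous_evalPoint (X : BoolSp.{u}) : Continuous (evalPoint (X := X) hK) := by
  refine continuous_generateFrom_iff.2 ?_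
  rintro _ ⟨a, rfl⟩
  exact ((isLocallyConstant_khatEval a).isClosed_fiber 0).isOpen_compl

theorem injective_evalPoint (X : BoolSp.{u}) :
    Function.Injective (evalPoint (X := X) hK) := by
  intro x y hxy
  by_contra hne
  obtain ⟨U, hU, hx, hy⟩ := exists_isClopen_of_totally_separated hne
  have : Nontrivial K := hK.nontrivial
  obtain ⟨a, ha⟩ := exists_khatEval_eq (LocallyConstant.charFn K hU)
  have hay : a ∈ (evalPoint hK y).1 := (ha y).trans ((LocallyConstant.charFn_eq_zero K y hU).2 hy)
  rw [← hxy, mem_evalPoint, ha, LocallyConstant.charFn_eq_zero] at hay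
  exact hay hx

theorem denseRange_evalPoint (X : BoolSp.{u}) : DenseRange (evalPoint (X := X) hK) := by
  refine (SpecInf.isTopologicalBasis_basicOpen _).dense_iff.2 ?_
  have key : ∀ (a : (Limits.colimit (powerDiagram K X)).carrier) (q), q ∈ SpecInf.basicOpen a →
      ∃ x : X, (khatEval x).hom a ≠ 0 := by
    intro a q hq
    by_contra! h
    exact hq (eq_zero_of_khatEval_eq_zero h ▸ q.1.zero_mem)
  rintro _ (rfl | ⟨a, rfl⟩) ⟨q, hq⟩
  -- the whole spectrum is the basic open set of `1`
  · obtain ⟨x, -⟩ := key 1 q fun h => q.2.1.ne_top ((Ideal.eq_top_iff_one _).2 h)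
    exact ⟨_, trivial, x, rfl⟩
  · obtain ⟨x, hx⟩ := key a q hq
    exact ⟨_, hx, x, rfl⟩

theorem bijective_evalPoint (X : BoolSp.{u}) : Function.Bijective (evalPoint (X := X) hK) := by
  have := SpecInf.totallySeparatedSpace (isVonNeumannRegular_colimit hK X)
  refine ⟨injective_evalPoint hK X, Set.range_eq_univ.1 ?_⟩
  rw [← (isCompact_range (continuous_evalPoint hK X)).isClosed.closure_eq]
  exact (denseRange_evalPoint hK X).closure_range

/-- The natural isomorphism `Id ≅ Spec^∞ ∘ k̂`, with components `evalPoint`. -/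
noncomputable def idIsoSpecKhat :
    𝟭 BoolSp.{u} ≅ (khat hK).rightOp ⋙ specFunctor.{u} :=
  NatIso.ofComponents
    (fun X => CompHausLike.isoOfBijective
      (ConcreteCategory.ofHom
        (⟨evalPoint hK, continuous_evalPoint hK X⟩ : C(X, specObj (khatObj hK X))))
      (bijective_evalPoint hK X))
    (fun {X Y} f => ConcreteCategory.hom_ext _ _ fun x => by
      change evalPoint hK (f x) = SpecInf.comap (khatMap f.hom.hom).hom (evalPoint hK x)
      refine Subtype.ext (Ideal.ext fun a => ?_)
      exact (congrArg (· = 0) (khatEval_khatMap f.hom.hom x a)).symm.to_iff)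

end EvalPoint

end CInfty

theorem theorem4 (K : Type u) [CInfty.CInftyRing K] (hK : CInfty.IsCInftyField K) :
    -- the natural isomorphism between the identity functor and the composite of `k̂` and `Spec^∞`
    Nonempty (𝟭 CInfty.BoolSp.{u} ≅ (CInfty.khat hK).rightOp ⋙ CInfty.specFunctor.{u}) ∧
    (CInfty.khat hK).Faithful ∧
    CInfty.FullUpToConjugation CInfty.specFunctor.{u} ∧
    CInfty.specFunctor.{u}.EssSurj ∧
    -- in particular, every Boolean space is the smooth spectrum of a von Neumann regular ring
    (∀ (X : Type u) [TopologicalSpace X] [CompactSpace X] [T2Space X]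
      [TotallyDisconnectedSpace X], ∃ (A : Type u) (_ : CInfty.CInftyRing A),
        CInfty.IsVonNeumannRegular A ∧ Nonempty (CInfty.SpecInf A ≃ₜ X)) := by
  have e := CInfty.idIsoSpecKhat hK
  have h_surj : CInfty.specFunctor.{u}.EssSurj := ⟨fun X => ⟨_, ⟨(e.app X).symm⟩⟩⟩
  refine ⟨⟨e⟩, ?_, ?_, h_surj, ?_⟩
  · have : (CInfty.khat hK).rightOp.Faithful := Functor.Faithful.of_comp_iso e.symm
    exact ⟨fun {X Y f g} h => Quiver.Hom.unop_inj
      ((CInfty.khat hK).rightOp.map_injective (Quiver.Hom.unop_inj h))⟩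
  · intro X Y φ
    refine ⟨_, _, (CInfty.khat hK).rightOp.map φ, e.app X, e.app Y, ?_⟩
    rw [← Category.assoc, Iso.eq_comp_inv]
    exact e.hom.naturality φ
  · intro X _ _ _ _
    obtain ⟨A, ⟨i⟩⟩ := h_surj.mem_essImage (Profinite.of X)
    exact ⟨A.unop.obj, inferInstance, A.unop.property, ⟨CompHausLike.homeoOfIso i⟩⟩
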